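/- An interior algebra is a Boolean algebra $A$ with an operator $g\colon A\to A$ such that $g(1)=1$, $g(a\cdot b)=g(a)\cdot g(b)$, $g(a)\le a$ and $g(g(a))=g(a)$ for all $a,b\in A$; homomorphisms are Boolean homomorphisms commuting with $g$. Let $\mathcal{O}$ be the functor from the category of interior algebras to the category of Heyting algebras that sends $A$ to the Heyting algebra $A^\circ=\{a\in A: g(a)=a\}$ of its open elements, which is a bounded sublattice of $A$ with implication $a\Rightarrow b=g(-a+b)$, and sends a homomorphism $h\colon A\to B$ to its restriction $h^\circ=h\restriction A^\circ\colon A^\circ\to B^\circ$. For a variety $\mathbf{V}$ of interior algebras, regarded as a full subcategory of the category of interior algebras, let $\gamma(\mathbf{V})$ be the class of all Heyting algebras isomorphic to $\mathcal{O}(A)$ for some $A\in\mathbf{V}$, regarded as a full subcategory of the category of Heyting algebras. An interior algebra is a $^*$-algebra if it is generated by its open elements; $\mathbf{V}$ is a $^*$-variety if $\mathbf{V}$ is the variety generated by the $^*$-algebras in $\mathbf{V}$; and $\mathbf{V}$ is locally finite if every finitely generated subalgebra of each algebra in $\mathbf{V}$ is finite. Theorem. Let $\mathbf{V}$ be a variety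 of interior algebras. Then the restriction of $\mathcal{O}$ to $\mathbf{V}$ is full (that is, for all $A,B\in\mathbf{V}$ every Heyting homomorphism $\mathcal{O}(A)\to\mathcal{O}(B)$ equals $\mathcal{O}(h)$ for some homomorphism $h\colon A\to B$) if and only if $\mathbf{V}$ is a locally finite $^*$-variety. In this case, $\mathbf{V}$ and $\gamma(\mathbf{V})$ are categorically equivalent, that is, there is a full and faithful functor $F\colon\mathbf{V}\to\gamma(\mathbf{V})$ such that every object of $\gamma(\mathbf{V})$ is isomorphic to $F(A)$ for some $A\in\mathbf{V}$. -/

import Mathlib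

open CategoryTheory

universe u v w

/-- An interior algebra: a Boolean algebra with an interior operator. -/
class InteriorAlgebra (α : Type u) extends BooleanAlgebra α where
  /-- The interior operator. -/
  int : α → α
  int_top : int ⊤ = ⊤
  int_inf : ∀ a b : α, int (a ⊓ b) = int a ⊓ int b
  int_le : ∀ a : α, int a ≤ a
  int_int : ∀ a : α, int (int a) = int a

namespace InteriorAlgebra

variable {α : Type u} [InteriorAlgebra α]

theorem int_mono {a b : α} (h : a ≤ b) : int a ≤ int b := by
  have h1 := int_inf a b
  rw [inf_eq_left.mpr h] at h1
  exact inf_eq_left.mp h1.symm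

theorem int_bot : int (⊥ : α) = ⊥ := le_bot_iff.mp (int_le _)

variable (α) in
/-- The open elements, i.e. the fixed points of the interior operator. -/
def Opens : Type u := {a : α // int a = a}

namespace Opens

instance : PartialOrder (Opens α) := inferInstanceAs (PartialOrder {a : α // int a = a})

/-- The Heyting algebra of open elements: the order and the bounded lattice operations are those
of the ambient algebra, and the implication is `a ⇨ b = int (aᶜ ⊔ b)`. -/
instance : HeytingAlgebra (Opens α) where
  sup a b := ⟨a.1 ⊔ b.1, le_antisymm (int_le _) (sup_le
    (a.2.symm.le.trans (int_mono le_sup_left)) (b.2.symm.le.trans (int_mono le_sup_right)))⟩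
  le_sup_left a b := (le_sup_left : a.1 ≤ a.1 ⊔ b.1)
  le_sup_right a b := (le_sup_right : b.1 ≤ a.1 ⊔ b.1)
  sup_le a b c h₁ h₂ := (sup_le h₁ h₂ : a.1 ⊔ b.1 ≤ c.1)
  inf a b := ⟨a.1 ⊓ b.1, by rw [int_inf, a.2, b.2]⟩
  inf_le_left a b := (inf_le_left : a.1 ⊓ b.1 ≤ a.1)
  inf_le_right a b := (inf_le_right : a.1 ⊓ b.1 ≤ b.1)
  le_inf a b c h₁ h₂ := (le_inf h₁ h₂ : a.1 ≤ b.1 ⊓ c.1)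
  top := ⟨⊤, int_top⟩
  le_top a := (le_top : a.1 ≤ ⊤)
  bot := ⟨⊥, int_bot⟩
  bot_le a := (bot_le : ⊥ ≤ a.1)
  himp a b := ⟨int (a.1ᶜ ⊔ b.1), int_int _⟩
  compl a := ⟨int (a.1ᶜ), int_int _⟩
  le_himp_iff a b c := by
    have key : a.1 ≤ b.1ᶜ ⊔ c.1 ↔ a.1 ⊓ b.1 ≤ c.1 := by
      rw [sup_comm, ← himp_eq, le_himp_iff]
    change a.1 ≤ int (b.1ᶜ ⊔ c.1) ↔ a.1 ⊓ b.1 ≤ c.1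
    rw [← key]
    exact ⟨fun h => h.trans (int_le _), fun h => a.2.symm.le.trans (int_mono h)⟩
  himp_bot a := Subtype.ext (congrArg int (sup_bot_eq a.1ᶜ))

end Opens

/-- A set closed under all operations of interior algebras. -/
structure IsSubalgebra (S : Set α) : Prop where
  bot_mem : ⊥ ∈ S
  top_mem : ⊤ ∈ S
  sup_mem : ∀ {a b : α}, a ∈ S → b ∈ S → a ⊔ b ∈ S
  inf_mem : ∀ {a b : α}, a ∈ S → b ∈ S → a ⊓ b ∈ S
  compl_mem : ∀ {a : α}, a ∈ S → aᶜ ∈ S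
  int_mem : ∀ {a : α}, a ∈ S → int a ∈ S

/-- The (universe of the) subalgebra generated by a set. -/
def generated (s : Set α) : Set α := ⋂₀ {S | IsSubalgebra S ∧ s ⊆ S}

variable (α) in
/-- A `*`-algebra is an interior algebra that is generated by its open elements. -/
def IsStarAlgebra : Prop := generated {a : α | int a = a} = Set.univ

end InteriorAlgebra

/-- A homomorphism of interior algebras: a homomorphism of bounded lattices (hence of Boolean
algebras) that commutes with the interior operators. -/
structure InteriorHom (α : Type u) (β : Type v) [InteriorAlgebra α] [InteriorAlgebra β]
    extends BoundedLatticeHom α β where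
  map_int' : ∀ a : α, toFun (InteriorAlgebra.int a) = InteriorAlgebra.int (toFun a)

namespace InteriorHom

open InteriorAlgebra

variable {α : Type u} {β : Type v} {γ : Type w}
  [InteriorAlgebra α] [InteriorAlgebra β] [InteriorAlgebra γ]

theorem ext {f g : InteriorHom α β} (h : f.toBoundedLatticeHom = g.toBoundedLatticeHom) :
    f = g := by
  cases f; cases g; cases h; rfl

theorem map_int (f : InteriorHom α β) (a : α) :
    f.toBoundedLatticeHom (int a) = int (f.toBoundedLatticeHom a) := f.map_int' a

variable (α) in
/-- The identity homomorphism. -/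
def id : InteriorHom α α where
  toBoundedLatticeHom := BoundedLatticeHom.id α
  map_int' _ := rfl

/-- Composition of homomorphisms. -/
def comp (g : InteriorHom β γ) (f : InteriorHom α β) : InteriorHom α γ where
  toBoundedLatticeHom := g.toBoundedLatticeHom.comp f.toBoundedLatticeHom
  map_int' a := (congrArg g.toBoundedLatticeHom (f.map_int a)).trans (g.map_int _)

/-- The restriction of a homomorphism to the Heyting algebras of open elements. -/
def restrictOpens (f : InteriorHom α β) : HeytingHom (Opens α) (Opens β) where
  toFun a := ⟨f.toBoundedLatticeHom a.1, by rw [← f.map_int, a.2]⟩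
  map_sup' a b := Subtype.ext (map_sup f.toBoundedLatticeHom a.1 b.1)
  map_inf' a b := Subtype.ext (map_inf f.toBoundedLatticeHom a.1 b.1)
  map_bot' := Subtype.ext (map_bot f.toBoundedLatticeHom)
  map_himp' a b := Subtype.ext (by
    change f.toBoundedLatticeHom (int (a.1ᶜ ⊔ b.1)) =
      int ((f.toBoundedLatticeHom a.1)ᶜ ⊔ f.toBoundedLatticeHom b.1)
    rw [f.map_int, map_sup, map_compl'])

end InteriorHom

/-- Bundled interior algebras. -/
structure IntAlg : Type (u + 1) where
  carrier : Type u
  [str : InteriorAlgebra carrier]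

namespace IntAlg

instance : CoeSort IntAlg.{u} (Type u) := ⟨IntAlg.carrier⟩

instance (A : IntAlg.{u}) : InteriorAlgebra A := A.str

/-- The category of interior algebras and their homomorphisms. -/
instance : Category.{u} IntAlg.{u} where
  Hom A B := InteriorHom A B
  id A := InteriorHom.id A
  comp f g := InteriorHom.comp g f

/-- The functor of open elements, from interior algebras to Heyting algebras. -/
def openFunctor : IntAlg.{u} ⥤ HeytAlg.{u} where
  obj A := HeytAlg.of (InteriorAlgebra.Opens A)
  map f := HeytAlg.ofHom (InteriorHom.restrictOpens f)
  map_id _ := rfl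
  map_comp _ _ := rfl

/-- Terms of the language of interior algebras, in countably many variables. -/
inductive Term : Type
  | var (n : ℕ) : Term
  | bot : Term
  | top : Term
  | sup (s t : Term) : Term
  | inf (s t : Term) : Term
  | compl (t : Term) : Term
  | int (t : Term) : Term

/-- The value of a term under an assignment of the variables. -/
def Term.eval {α : Type u} [InteriorAlgebra α] (x : ℕ → α) : Term → α
  | .var n => x n
  | .bot => ⊥
  | .top => ⊤
  | .sup s t => s.eval x ⊔ t.eval x
  | .inf s t => s.eval x ⊓ t.eval x
  | .compl t => (t.eval x)ᶜ
  | .int t => InteriorAlgebra.int (t.eval x)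

/-- The algebra satisfies the identity `s ≈ t`. -/
def Satisfies (A : IntAlg.{u}) (s t : Term) : Prop :=
  ∀ x : ℕ → A, s.eval x = t.eval x

/-- A variety of interior algebras: a class of interior algebras defined by identities. -/
def IsVariety (V : ObjectProperty IntAlg.{u}) : Prop :=
  ∃ E : Set (Term × Term), ∀ A : IntAlg.{u}, V A ↔ ∀ e ∈ E, A.Satisfies e.1 e.2

/-- The variety generated by a class: the least variety that contains it. -/
def varietyGenerated (K : ObjectProperty IntAlg.{u}) : ObjectProperty IntAlg.{u} :=
  fun A => ∀ W : ObjectProperty IntAlg.{u}, IsVariety W → (∀ B, K B → W B) → W A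

/-- The variety `V*` generated by the `*`-algebras in `V`. -/
def starPart (V : ObjectProperty IntAlg.{u}) : ObjectProperty IntAlg.{u} :=
  varietyGenerated fun A => V A ∧ InteriorAlgebra.IsStarAlgebra A

/-- `V` is a `*`-variety if `V = V*`. -/
def IsStarVariety (V : ObjectProperty IntAlg.{u}) : Prop := V = starPart V

/-- In every algebra of the class, finitely generated subalgebras are finite. -/
def IsLocallyFinite (V : ObjectProperty IntAlg.{u}) : Prop :=
  ∀ A : IntAlg.{u}, V A → ∀ s : Set A, s.Finite → (InteriorAlgebra.generated s).Finite

/-- The class of the Heyting algebras of open elements of the algebras in `V`, up to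
isomorphism. -/
def gamma (V : ObjectProperty IntAlg.{u}) : ObjectProperty HeytAlg.{u} :=
  fun L => ∃ A : IntAlg.{u}, V A ∧ Nonempty (openFunctor.obj A ≅ L)

end IntAlg

/-- Categorical equivalence: there is a full and faithful functor such that each object of the
target is isomorphic to the image of an object of the source. -/
def CategoricallyEquivalent (C : Type (u + 1)) [Category.{u} C] (D : Type (u + 1))
    [Category.{u} D] : Prop :=
  ∃ F : C ⥤ D, F.Full ∧ F.Faithful ∧ ∀ d : D, ∃ c : C, Nonempty (F.obj c ≅ d)

/-!
Everything reduces to one condition: every member of `V` is a `*`-algebra.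

A Heyting homomorphism `f` between algebras of open elements extends to a homomorphism of interior
algebras as soon as the source is a `*`-algebra: in `α × β`, the Boolean subalgebra generated by
the graph of `f` has no open elements outside the graph, so it is itself the graph of a function.
Conversely, if `𝒪` is full on `V`, then for `A` in `V` the identity of the open elements extends to
a retraction of `A` onto its subalgebra generated by the open elements, and a homomorphism that is
injective on open elements is injective.

The link with local finiteness goes through the ultrafilters of the underlying Boolean algebra,
preordered so that open elements are upward closed. In a `*`-algebra, membership in a given element
changes only boundedly often along chains of ultrafilters. Applied to `A` itself this gives the
Grzegorczyk inequality, which passes to the generated variety and which forces a locally finite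
algebra to be a `*`-algebra. Applied to the power `ℕ → A` it bounds the lengths of chains of
ultrafilters of `A`, because every finite chain has an element whose membership changes at each
step; and a finitely generated `*`-algebra has finitely many ultrafilters of each coheight.
-/

/-- A homomorphism to `Prop` encodes the prime filter of the elements that it sends to `True`. -/
theorem exists_boundedLatticeHom_prop_of_notMem {α : Type u} [DistribLattice α] [BoundedOrder α]
    (F : Order.PFilter α) {a : α} (ha : a ∉ F) :
    ∃ x : BoundedLatticeHom α Prop, (∀ b ∈ F, x b) ∧ ¬ x a := by
  have hdisj : Disjoint (F : Set α) (Order.Ideal.principal a : Set α) :=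
    Set.disjoint_left.mpr fun b hb hba => ha (F.mem_of_le hba hb)
  obtain ⟨J, hJ, haJ, hFJ⟩ := DistribLattice.prime_ideal_of_disjoint_filter_ideal hdisj
  refine ⟨{ toFun := fun b => b ∉ J
            map_sup' := fun b c => ?_
            map_inf' := fun b c => ?_
            map_top' := eq_true hJ.top_notMem
            map_bot' := eq_false (not_not_intro J.bot_mem) }, ?_, ?_⟩
  · simp only [Order.Ideal.sup_mem_iff, sup_Prop_eq, not_and_or]
  · have : b ⊓ c ∈ J ↔ b ∈ J ∨ c ∈ J :=
      ⟨hJ.mem_or_mem, Or.rec (J.lower inf_le_left) (J.lower inf_le_right)⟩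
    simp only [this, inf_Prop_eq, not_or]
  · exact fun b hb => Set.disjoint_left.mp hFJ hb
  · exact not_not_intro (haJ Order.Ideal.mem_principal_self)

namespace InteriorAlgebra

variable {α : Type u} {β : Type v} [InteriorAlgebra α] [InteriorAlgebra β]

theorem int_eq_top_iff {a : α} : int a = ⊤ ↔ a = ⊤ :=
  ⟨fun h => top_le_iff.mp (h.ge.trans (int_le a)), fun h => by rw [h, int_top]⟩

theorem int_compl_sup_eq_top_iff {a b : α} : int (aᶜ ⊔ b) = ⊤ ↔ a ≤ b := by
  rw [int_eq_top_iff, sup_comm, ← himp_eq, himp_eq_top_iff]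

/-! ### Subalgebras and products -/

theorem subset_generated (s : Set α) : s ⊆ generated s :=
  Set.subset_sInter fun _ h => h.2

theorem generated_subset {s S : Set α} (hS : IsSubalgebra S) (h : s ⊆ S) : generated s ⊆ S :=
  Set.sInter_subset_of_mem ⟨hS, h⟩

theorem isSubalgebra_generated (s : Set α) : IsSubalgebra (generated s) where
  bot_mem := fun _ h => h.1.bot_mem
  top_mem := fun _ h => h.1.top_mem
  sup_mem := fun ha hb S h => h.1.sup_mem (ha S h) (hb S h)
  inf_mem := fun ha hb S h => h.1.inf_mem (ha S h) (hb S h)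
  compl_mem := fun ha S h => h.1.compl_mem (ha S h)
  int_mem := fun ha S h => h.1.int_mem (ha S h)

theorem IsStarAlgebra.induction (hα : IsStarAlgebra α) {p : α → Prop}
    (isOpen : ∀ a, int a = a → p a) (compl : ∀ a, p a → p aᶜ)
    (sup : ∀ a b, p a → p b → p (a ⊔ b)) (a : α) : p a := by
  have hS : IsSubalgebra {a | p a} :=
    { bot_mem := isOpen _ int_bot
      top_mem := isOpen _ int_top
      sup_mem := sup _ _
      inf_mem := fun {a b} ha hb => by
        rw [← compl_compl (a ⊓ b), compl_inf]
        exact compl _ (sup _ _ (compl _ ha) (compl _ hb))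
      compl_mem := compl _
      int_mem := fun _ => isOpen _ (int_int _) }
  exact generated_subset hS isOpen (hα.ge (Set.mem_univ a))

theorem IsSubalgebra.image {S : Set α} (hS : IsSubalgebra S) (h : InteriorHom α β) :
    IsSubalgebra (h.toBoundedLatticeHom '' S) where
  bot_mem := ⟨⊥, hS.bot_mem, map_bot _⟩
  top_mem := ⟨⊤, hS.top_mem, map_top _⟩
  sup_mem := by rintro _ _ ⟨a, ha, rfl⟩ ⟨b, hb, rfl⟩; exact ⟨_, hS.sup_mem ha hb, map_sup _ _ _⟩
  inf_mem := by rintro _ _ ⟨a, ha, rfl⟩ ⟨b, hb, rfl⟩; exact ⟨_, hS.inf_mem ha hb, map_inf _ _ _⟩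
  compl_mem := by rintro _ ⟨a, ha, rfl⟩; exact ⟨_, hS.compl_mem ha, map_compl' _ _⟩
  int_mem := by rintro _ ⟨a, ha, rfl⟩; exact ⟨_, hS.int_mem ha, h.map_int a⟩

/-- A set closed under the operations of interior algebras, bundled as a Boolean subalgebra in
order to serve as the carrier of an interior algebra. -/
def IsSubalgebra.toBooleanSubalgebra {S : Set α} (hS : IsSubalgebra S) : BooleanSubalgebra α where
  carrier := S
  supClosed' _ ha _ hb := hS.sup_mem ha hb
  infClosed' _ ha _ hb := hS.inf_mem ha hb
  compl_mem' := hS.compl_mem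
  bot_mem' := hS.bot_mem

instance {S : Set α} (hS : IsSubalgebra S) : InteriorAlgebra hS.toBooleanSubalgebra where
  int a := ⟨int a.1, hS.int_mem a.2⟩
  int_top := Subtype.ext int_top
  int_inf a b := Subtype.ext (int_inf a.1 b.1)
  int_le a := int_le a.1
  int_int a := Subtype.ext (int_int a.1)

/-- The inclusion of a subalgebra. -/
def IsSubalgebra.inclusion {S : Set α} (hS : IsSubalgebra S) :
    InteriorHom hS.toBooleanSubalgebra α where
  toBoundedLatticeHom := hS.toBooleanSubalgebra.subtype
  map_int' _ := rfl

theorem generated_preimage_val (s : Set α) :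
    generated (Subtype.val ⁻¹' s : Set (isSubalgebra_generated s).toBooleanSubalgebra) =
      Set.univ := by
  have hS := (isSubalgebra_generated
    (Subtype.val ⁻¹' s : Set (isSubalgebra_generated s).toBooleanSubalgebra)).image
      (isSubalgebra_generated s).inclusion
  refine Set.eq_univ_of_forall fun a => ?_
  obtain ⟨b, hb, hba⟩ := generated_subset hS
    (fun x hx => ⟨⟨x, subset_generated s hx⟩, subset_generated _ hx, rfl⟩) a.2
  rwa [← Subtype.ext hba]

theorem isStarAlgebra_generated_isOpen :
    IsStarAlgebra (isSubalgebra_generated {a : α | int a = a}).toBooleanSubalgebra := by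
  refine Eq.trans (congrArg generated (Set.ext fun a => ?_))
    (generated_preimage_val {a : α | int a = a})
  exact Subtype.ext_iff

instance : InteriorAlgebra (α × β) where
  int a := (int a.1, int a.2)
  int_top := Prod.ext int_top int_top
  int_inf a b := Prod.ext (int_inf a.1 b.1) (int_inf a.2 b.2)
  int_le a := ⟨int_le a.1, int_le a.2⟩
  int_int a := Prod.ext (int_int a.1) (int_int a.2)

instance {ι : Type v} {A : ι → Type u} [∀ i, InteriorAlgebra (A i)] :
    InteriorAlgebra (∀ i, A i) where
  int a i := int (a i)
  int_top := funext fun _ => int_top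
  int_inf a b := funext fun i => int_inf (a i) (b i)
  int_le a i := int_le (a i)
  int_int a := funext fun i => int_int (a i)

/-- The projection of a product to a factor. -/
def evalHom {ι : Type v} {A : ι → Type u} [∀ i, InteriorAlgebra (A i)] (i : ι) :
    InteriorHom (∀ i, A i) (A i) where
  toFun a := a i
  map_sup' _ _ := rfl
  map_inf' _ _ := rfl
  map_top' := rfl
  map_bot' := rfl
  map_int' _ := rfl

/-! ### Homomorphisms and their restrictions to open elements -/

theorem _root_.InteriorHom.eq_of_restrictOpens_eq (hα : IsStarAlgebra α) {g h : InteriorHom α β}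
    (e : g.restrictOpens = h.restrictOpens) : g = h := by
  refine InteriorHom.ext (DFunLike.ext _ _ fun a => ?_)
  induction a using hα.induction with
  | isOpen a ha => exact congrArg Subtype.val (DFunLike.congr_fun e (⟨a, ha⟩ : Opens α))
  | compl a ha => rw [map_compl', map_compl', ha]
  | sup a b ha hb => rw [map_sup, map_sup, ha, hb]

theorem _root_.InteriorHom.injective_of_restrictOpens (h : InteriorHom α β)
    (hinj : Function.Injective h.restrictOpens) : Function.Injective h.toBoundedLatticeHom := by
  have le_of_map_eq : ∀ a b : α, h.toBoundedLatticeHom a = h.toBoundedLatticeHom b → a ≤ b := by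
    intro a b hab
    let u : Opens α := ⟨int (aᶜ ⊔ b), int_int _⟩
    have hmap : h.toBoundedLatticeHom (int (aᶜ ⊔ b)) = ⊤ := by
      rw [h.map_int, map_sup, map_compl', int_compl_sup_eq_top_iff, hab]
    have htop : u = ⊤ := hinj (by rw [map_top]; exact Subtype.ext hmap)
    exact int_compl_sup_eq_top_iff.mp (congrArg Subtype.val htop)
  exact fun a b hab => le_antisymm (le_of_map_eq a b hab) (le_of_map_eq b a hab.symm)

theorem int_mem_of_mem_closure {U : Set α} (hU : IsSublattice U) (hbot : ⊥ ∈ U)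
    (himp : ∀ u ∈ U, ∀ v ∈ U, int (uᶜ ⊔ v) ∈ U) {x : α}
    (hx : x ∈ BooleanSubalgebra.closure U) : int x ∈ U := by
  have htop : ⊤ ∈ U := by simpa [int_top] using himp ⊥ hbot ⊥ hbot
  have int_compl_mem : ∀ x ∈ BooleanSubalgebra.closure U, int xᶜ ∈ U := by
    intro x hx
    induction x, hx using BooleanSubalgebra.closure_sdiff_sup_induction hU hbot htop with
    | sdiff u hu v hv =>
      rw [sdiff_eq, compl_inf, compl_compl]
      exact himp u hu v hv
    | sup x _ y _ hx hy =>
      rw [compl_sup, int_inf]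
      exact hU.infClosed hx hy
  simpa only [compl_compl] using int_compl_mem xᶜ (BooleanSubalgebra.compl_mem hx)

/-- The graph of a Heyting homomorphism between the algebras of open elements, as a set of open
elements of the product. -/
def opensGraph (f : HeytingHom (Opens α) (Opens β)) : Set (α × β) :=
  Set.range fun u => (u.1, (f u).1)

section Extension

variable (f : HeytingHom (Opens α) (Opens β))

theorem isSublattice_opensGraph : IsSublattice (opensGraph f) where
  supClosed := by
    rintro _ ⟨u, rfl⟩ _ ⟨v, rfl⟩
    exact ⟨u ⊔ v, by simp only [map_sup]; rfl⟩
  infClosed := by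
    rintro _ ⟨u, rfl⟩ _ ⟨v, rfl⟩
    exact ⟨u ⊓ v, by simp only [map_inf]; rfl⟩

theorem int_mem_opensGraph_of_mem_closure {x : α × β}
    (hx : x ∈ BooleanSubalgebra.closure (opensGraph f)) : int x ∈ opensGraph f := by
  refine int_mem_of_mem_closure (isSublattice_opensGraph f)
    ⟨⊥, Prod.ext rfl (congrArg Subtype.val (map_bot f))⟩ ?_ hx
  rintro _ ⟨u, rfl⟩ _ ⟨v, rfl⟩
  exact ⟨u ⇨ v, by simp only [map_himp]; rfl⟩

theorem le_of_mem_closure_opensGraph {a : α} {b c : β}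
    (hb : (a, b) ∈ BooleanSubalgebra.closure (opensGraph f))
    (hc : (a, c) ∈ BooleanSubalgebra.closure (opensGraph f)) : b ≤ c := by
  obtain ⟨u, hu⟩ := int_mem_opensGraph_of_mem_closure f
    (BooleanSubalgebra.sup_mem (BooleanSubalgebra.compl_mem hb) hc)
  have hutop : u = ⊤ :=
    Subtype.ext ((congrArg Prod.fst hu).trans (int_compl_sup_eq_top_iff.mpr le_rfl))
  have hfu : (f u).1 = ⊤ := congrArg Subtype.val (hutop ▸ map_top f)
  exact int_compl_sup_eq_top_iff.mp ((congrArg Prod.snd hu).symm.trans hfu)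

theorem IsStarAlgebra.exists_mem_closure_opensGraph (hα : IsStarAlgebra α) (a : α) :
    ∃ b, (a, b) ∈ BooleanSubalgebra.closure (opensGraph f) := by
  induction a using hα.induction with
  | isOpen u hu => exact ⟨_, BooleanSubalgebra.subset_closure ⟨⟨u, hu⟩, rfl⟩⟩
  | compl a ha =>
    obtain ⟨b, hb⟩ := ha
    exact ⟨bᶜ, BooleanSubalgebra.compl_mem hb⟩
  | sup a c ha hc =>
    obtain ⟨b, hb⟩ := ha
    obtain ⟨d, hd⟩ := hc
    exact ⟨b ⊔ d, BooleanSubalgebra.sup_mem hb hd⟩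

theorem IsStarAlgebra.exists_restrictOpens_eq (hα : IsStarAlgebra α) :
    ∃ h : InteriorHom α β, h.restrictOpens = f := by
  choose h mem_closure using hα.exists_mem_closure_opensGraph f
  have eq_of_mem : ∀ {a b}, (a, b) ∈ BooleanSubalgebra.closure (opensGraph f) → h a = b :=
    fun hab => le_antisymm (le_of_mem_closure_opensGraph f (mem_closure _) hab)
      (le_of_mem_closure_opensGraph f hab (mem_closure _))
  have eq_of_mem_graph : ∀ {a b}, (a, b) ∈ opensGraph f → h a = b :=
    fun hab => eq_of_mem (BooleanSubalgebra.subset_closure hab)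
  refine ⟨{ toFun := h
            map_sup' := fun a b =>
              eq_of_mem (BooleanSubalgebra.sup_mem (mem_closure a) (mem_closure b))
            map_inf' := fun a b =>
              eq_of_mem (BooleanSubalgebra.inf_mem (mem_closure a) (mem_closure b))
            map_top' := eq_of_mem BooleanSubalgebra.top_mem
            map_bot' := eq_of_mem BooleanSubalgebra.bot_mem
            map_int' := fun a =>
              eq_of_mem_graph (int_mem_opensGraph_of_mem_closure f (mem_closure a)) }, ?_⟩
  exact DFunLike.ext _ _ fun u => Subtype.ext (eq_of_mem_graph ⟨u, rfl⟩)

end Extension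

/-- The open elements, regarded as open elements of the subalgebra that they generate. -/
def opensToGenerated : HeytingHom (Opens α)
    (Opens (isSubalgebra_generated {a : α | int a = a}).toBooleanSubalgebra) where
  toFun u := ⟨⟨u.1, subset_generated _ u.2⟩, Subtype.ext u.2⟩
  map_sup' _ _ := rfl
  map_inf' _ _ := rfl
  map_bot' := rfl
  map_himp' _ _ := rfl

theorem isStarAlgebra_of_restrictOpens_eq_opensToGenerated
    {h : InteriorHom α (isSubalgebra_generated {a : α | int a = a}).toBooleanSubalgebra}
    (hh : h.restrictOpens = opensToGenerated) : IsStarAlgebra α := by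
  have hinj : Function.Injective h.toBoundedLatticeHom := by
    refine h.injective_of_restrictOpens fun u v huv => Subtype.ext ?_
    rw [hh] at huv
    exact congrArg (fun w => w.1.1) huv
  have retraction : h.comp (isSubalgebra_generated _).inclusion = InteriorHom.id _ := by
    refine InteriorHom.eq_of_restrictOpens_eq isStarAlgebra_generated_isOpen
      (DFunLike.ext _ _ fun u => Subtype.ext ?_)
    exact congrArg Subtype.val
      (DFunLike.congr_fun hh (⟨u.1.1, congrArg Subtype.val u.2⟩ : Opens α))
  refine Set.eq_univ_of_forall fun a => ?_
  have hidem : h.toBoundedLatticeHom (h.toBoundedLatticeHom a).1 = h.toBoundedLatticeHom a :=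
    congrArg (fun g => g.toBoundedLatticeHom (h.toBoundedLatticeHom a)) retraction
  exact hinj hidem ▸ (h.toBoundedLatticeHom a).2

/-! ### Ultrafilters -/

variable (α) in
/-- An ultrafilter of the underlying Boolean algebra, encoded as a homomorphism to the two-element
algebra `Prop`: the elements of the ultrafilter `x` are the `a` with `x a`. -/
def Point : Type u := BoundedLatticeHom α Prop

namespace Point

instance : FunLike (Point α) α Prop := inferInstanceAs (FunLike (BoundedLatticeHom α Prop) α Prop)

instance : BoundedLatticeHomClass (Point α) α Prop :=
  inferInstanceAs (BoundedLatticeHomClass (BoundedLatticeHom α Prop) α Prop)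

/-- Open elements are upward closed for this preorder, the accessibility relation of the canonical
Kripke frame. -/
instance : Preorder (Point α) where
  le x y := ∀ a, x (int a) → y (int a)
  le_refl _ _ h := h
  le_trans _ _ _ hxy hyz a ha := hyz a (hxy a ha)

variable {x y : Point α} {a b : α}

theorem apply_of_le (h : a ≤ b) : x a → x b := OrderHomClass.mono x h

theorem compl_apply : x aᶜ ↔ ¬ x a := by rw [map_compl', compl_iff_not]

theorem sup_apply : x (a ⊔ b) ↔ x a ∨ x b := by simp only [map_sup, sup_Prop_eq]

theorem symmDiff_apply : x (symmDiff a b) ↔ ¬ (x a ↔ x b) := by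
  simp only [symmDiff, sdiff_eq, sup_apply, map_inf, compl_apply, inf_Prop_eq]
  tauto

theorem le_of_forall_apply (h : ∀ x : Point α, x a → x b) : a ≤ b := by
  by_contra hab
  obtain ⟨x, hx, hb⟩ :=
    exists_boundedLatticeHom_prop_of_notMem (Order.PFilter.principal a) (a := b)
      (by rwa [Order.PFilter.mem_principal])
  exact hb (h x (hx a (Order.PFilter.mem_principal.mpr le_rfl)))

theorem int_apply_iff : x (int a) ↔ ∀ y, x ≤ y → y a := by
  refine ⟨fun h y hxy => apply_of_le (int_le a) (hxy a h), fun h => ?_⟩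
  by_contra ha
  have hF : Order.IsPFilter {b | x (int b)} := Order.IsPFilter.of_def
    ⟨⊤, by simp [int_top]⟩
    (fun b hb c hc => ⟨b ⊓ c, by simpa [int_inf] using ⟨hb, hc⟩, inf_le_left, inf_le_right⟩)
    fun h => apply_of_le (int_mono h)
  obtain ⟨y, hxy, hya⟩ := exists_boundedLatticeHom_prop_of_notMem hF.toPFilter (a := a) ha
  refine hya (h y fun b hb => hxy (int b) ?_)
  change x (int (int b))
  rwa [int_int]

theorem exists_le_not_apply_of_not_int_apply (h : ¬ x (int a)) : ∃ y, x ≤ y ∧ ¬ y a := by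
  simpa only [int_apply_iff, not_forall, exists_prop] using h

/-- The preimage of an ultrafilter under a homomorphism. -/
noncomputable def comap (h : InteriorHom α β) (x : Point β) : Point α :=
  BoundedLatticeHom.comp x h.toBoundedLatticeHom

theorem comap_mono (h : InteriorHom α β) : Monotone (comap h) := by
  intro x y hxy a ha
  change y (h.toBoundedLatticeHom (int a))
  rw [h.map_int]
  refine hxy _ ?_
  rw [← h.map_int]
  exact ha

/-- The steps of a chain of ultrafilters at which membership of `a` changes. -/
def jumps (a : α) {n : ℕ} (f : Fin (n + 1) → Point α) : Set (Fin n) :=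
  {j | f j.castSucc a ≠ f j.succ a}

theorem exists_jumps_eq_univ {n : ℕ} {f : Fin (n + 1) → Point α} (hf : StrictMono f) :
    ∃ a, jumps a f = Set.univ := by
  induction n with
  | zero => exact ⟨⊥, Set.eq_univ_of_forall fun j => j.elim0⟩
  | succ n ih =>
    obtain ⟨a, ha⟩ := ih (hf.comp Fin.strictMono_succ)
    have tail_ne : ∀ j : Fin n, f j.castSucc.succ a ≠ f j.succ.succ a :=
      Set.eq_univ_iff_forall.mp ha
    obtain ⟨u, hu0, hu1⟩ : ∃ u, ¬ f 0 (int u) ∧ f 1 (int u) := by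
      have not_le : ¬ ∀ u, f 1 (int u) → f 0 (int u) := (hf Fin.zero_lt_one).not_ge
      simpa only [not_forall, exists_prop, and_comm] using not_le
    have hu : ∀ j : Fin (n + 1), f j.succ (int u) := fun j =>
      hf.monotone (Fin.succ_le_succ_iff.mpr (Fin.zero_le j)) u hu1
    by_cases h0 : f 0 a = f 1 a
    · -- `int u` separates `f 0` from all other terms, so its addition affects the first step only.
      refine ⟨symmDiff a (int u), Set.eq_univ_of_forall (Fin.cases ?_ fun j => ?_)⟩
      · change f 0 _ ≠ f 1 _
        simp only [ne_eq, eq_iff_iff, symmDiff_apply, h0, hu0, hu1]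
        tauto
      · change f j.castSucc.succ _ ≠ f j.succ.succ _
        simpa only [ne_eq, eq_iff_iff, symmDiff_apply, hu, iff_true, not_iff_not] using tail_ne j
    · exact ⟨a, Set.eq_univ_of_forall (Fin.cases h0 tail_ne)⟩

end Point

theorem IsStarAlgebra.point_eq_of_le_of_le (hα : IsStarAlgebra α) {x y : Point α} (hxy : x ≤ y)
    (hyx : y ≤ x) : x = y := by
  refine DFunLike.ext _ _ fun a => ?_
  induction a using hα.induction with
  | isOpen a ha => exact propext (ha ▸ ⟨hxy a, hyx a⟩)
  | compl a ha => rw [map_compl', map_compl', ha]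
  | sup a b ha hb => rw [map_sup, map_sup, ha, hb]

/-! ### The Grzegorczyk inequality -/

variable (α) in
/-- The Grzegorczyk inequality `g (-g (-a + g a) + a) ≤ a`. It is an identity that holds in all
`*`-algebras and hence in the variety that they generate. -/
def IsGrz : Prop := ∀ a : α, int ((int (aᶜ ⊔ int a))ᶜ ⊔ a) ≤ a

theorem IsStarAlgebra.exists_forall_le_apply_eq (hα : IsStarAlgebra α) (a : α) :
    ∀ {T : Set (Point α)}, T.Nonempty → ∃ y ∈ T, ∀ z ∈ T, y ≤ z → z a = y a := by
  induction a using hα.induction with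
  | isOpen a ha =>
    intro T hT
    by_cases h : ∃ y ∈ T, y a
    · obtain ⟨y, hyT, hya⟩ := h
      rw [← ha] at hya ⊢
      exact ⟨y, hyT, fun z _ hyz => propext ⟨fun _ => hya, fun _ => hyz a hya⟩⟩
    · push Not at h
      obtain ⟨y, hyT⟩ := hT
      exact ⟨y, hyT, fun z hzT _ => propext (iff_of_false (h z hzT) (h y hyT))⟩
  | compl a ha =>
    intro T hT
    simpa only [map_compl', compl_inj_iff] using ha hT
  | sup a b ha hb =>
    intro T hT
    obtain ⟨y, hyT, hya⟩ := ha hT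
    obtain ⟨z, ⟨hzT, hyz⟩, hzb⟩ := hb (T := T ∩ Set.Ici y) ⟨y, hyT, Set.self_mem_Ici⟩
    refine ⟨z, hzT, fun w hwT hzw => ?_⟩
    have hyw : y ≤ w := hyz.trans hzw
    rw [map_sup, map_sup, hya w hwT hyw, hya z hzT hyz, hzb w ⟨hwT, hyw⟩ hzw]

theorem IsStarAlgebra.isGrz (hα : IsStarAlgebra α) : IsGrz α := by
  refine fun a => Point.le_of_forall_apply fun x hx => ?_
  by_contra hxa
  -- If the inequality fails at `x`, then each point of `T` has points of `T` above it both inside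
  -- and outside `a`.
  let T : Set (Point α) := {y | x ≤ y ∧ ¬ y (int a)}
  have not_int_apply {y : Point α} (h : ¬ y a) : ¬ y (int a) :=
    fun h' => h (Point.apply_of_le (int_le a) h')
  obtain ⟨y, ⟨hxy, hya⟩, hconst⟩ :=
    hα.exists_forall_le_apply_eq a (T := T) ⟨x, le_rfl, not_int_apply hxa⟩
  have not_apply : ¬ y a := by
    obtain ⟨z, hyz, hza⟩ := Point.exists_le_not_apply_of_not_int_apply hya
    rwa [← hconst z ⟨hxy.trans hyz, not_int_apply hza⟩ hyz]
  have not_int_imp_apply : ¬ y (int (aᶜ ⊔ int a)) :=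
    Point.compl_apply.mp
      ((Point.sup_apply.mp (Point.int_apply_iff.mp hx y hxy)).resolve_right not_apply)
  obtain ⟨z, hyz, hz⟩ := Point.exists_le_not_apply_of_not_int_apply not_int_imp_apply
  rw [Point.sup_apply, Point.compl_apply, not_or, not_not] at hz
  exact not_apply (hconst z ⟨hxy.trans hyz, hz.2⟩ hyz ▸ hz.1)

theorem int_sup_int_compl_sdiff (p : α) :
    int (p ⊔ int pᶜ) \ int pᶜ = int (p ⊔ int pᶜ) ⊓ p := by
  refine le_antisymm (le_inf sdiff_le (sdiff_le_iff'.mpr (int_le _)))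
    (le_sdiff.mpr ⟨inf_le_left, ?_⟩)
  exact disjoint_compl_right.mono inf_le_right (int_le _)

theorem IsGrz.int_sup_int_compl_inf_ne_bot (hα : IsGrz α) {p : α} (hp : p ≠ ⊥) :
    int (p ⊔ int pᶜ) ⊓ p ≠ ⊥ := by
  intro h
  have hcompl := hα pᶜ
  rw [compl_compl, ← compl_inf, h, compl_bot, int_top, top_le_iff, compl_eq_top] at hcompl
  exact hp hcompl

theorem IsGrz.subset_generated_isOpen (hα : IsGrz α) {S : Set α} (hS : IsSubalgebra S)
    (hfin : S.Finite) : S ⊆ generated {a : α | int a = a} := by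
  have hG := isSubalgebra_generated {a : α | int a = a}
  have int_mem (a : α) : int a ∈ generated {a : α | int a = a} := subset_generated _ (int_int a)
  intro p hp
  refine (hfin.wellFoundedOn (r := (· < ·))).induction hp fun p hp ih => ?_
  by_cases hp0 : p = ⊥
  · exact hp0 ▸ hG.bot_mem
  set q := int (p ⊔ int pᶜ) ⊓ p with hq
  have hqS : q ∈ S := hS.inf_mem (hS.int_mem (hS.sup_mem hp (hS.int_mem (hS.compl_mem hp)))) hp
  have hqG : q ∈ generated {a : α | int a = a} := by
    rw [hq, ← int_sup_int_compl_sdiff, sdiff_eq]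
    exact hG.inf_mem (int_mem _) (hG.compl_mem (int_mem _))
  have hpqG : p \ q ∈ generated {a : α | int a = a} := by
    refine ih (p \ q) ?_ (sdiff_lt inf_le_right (hα.int_sup_int_compl_inf_ne_bot hp0))
    rw [sdiff_eq]
    exact hS.inf_mem hp (hS.compl_mem hqS)
  rw [← sdiff_sup_cancel (inf_le_right : q ≤ p)]
  exact hG.sup_mem hpqG hqG

theorem IsGrz.isStarAlgebra (hα : IsGrz α) (hfin : ∀ a : α, (generated {a}).Finite) :
    IsStarAlgebra α :=
  Set.eq_univ_of_forall fun a =>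
    hα.subset_generated_isOpen (isSubalgebra_generated {a}) (hfin a) (subset_generated _ rfl)

/-! ### Finiteness of finitely generated `*`-algebras -/

theorem IsStarAlgebra.exists_encard_jumps_le (hα : IsStarAlgebra α) (a : α) :
    ∃ N : ℕ, ∀ (n : ℕ) (f : Fin (n + 1) → Point α), Monotone f →
      (Point.jumps a f).encard ≤ N := by
  induction a using hα.induction with
  | isOpen a ha =>
    refine ⟨1, fun n f hf => Set.encard_le_one_iff.mpr fun j k hj hk => ?_⟩
    have persists {i l : Fin (n + 1)} (hil : i ≤ l) (h : f i a) : f l a := by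
      rw [← ha] at h ⊢
      exact hf hil a h
    have enters {j : Fin n} (hj : j ∈ Point.jumps a f) : ¬ f j.castSucc a ∧ f j.succ a := by
      have := persists (Fin.castSucc_le_succ j)
      have : ¬ (f j.castSucc a ↔ f j.succ a) := fun h => hj (propext h)
      tauto
    by_contra hjk
    rcases lt_or_gt_of_ne hjk with hjk | hkj
    · exact (enters hk).1 (persists (Fin.succ_le_castSucc_iff.mpr hjk) (enters hj).2)
    · exact (enters hj).1 (persists (Fin.succ_le_castSucc_iff.mpr hkj) (enters hk).2)
  | compl a ha =>
    have jumps_compl {n : ℕ} (f : Fin (n + 1) → Point α) :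
        Point.jumps aᶜ f = Point.jumps a f := by
      simp only [Point.jumps, map_compl', ne_eq, compl_inj_iff]
    simpa only [jumps_compl] using ha
  | sup a b ha hb =>
    obtain ⟨M, hM⟩ := ha
    obtain ⟨N, hN⟩ := hb
    refine ⟨M + N, fun n f hf => ?_⟩
    have jumps_sup_subset : Point.jumps (a ⊔ b) f ⊆ Point.jumps a f ∪ Point.jumps b f := by
      intro j hj
      by_contra! h
      simp only [Point.jumps, Set.mem_union, Set.mem_ofPred_eq, not_or, not_not] at h
      exact hj (by rw [map_sup, map_sup, h.1, h.2])
    calc (Point.jumps (a ⊔ b) f).encard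
        ≤ (Point.jumps a f ∪ Point.jumps b f).encard := Set.encard_le_encard jumps_sup_subset
      _ ≤ (Point.jumps a f).encard + (Point.jumps b f).encard := Set.encard_union_le _ _
      _ ≤ (M + N : ℕ) := by push_cast; exact add_le_add (hM n f hf) (hN n f hf)

theorem IsStarAlgebra.exists_length_le (hpow : IsStarAlgebra (ℕ → α)) :
    ∃ N : ℕ, ∀ p : LTSeries (Point α), p.length ≤ N := by
  by_contra! h
  choose p hp using h
  choose a ha using fun m => Point.exists_jumps_eq_univ (p m).strictMono
  obtain ⟨N, hN⟩ := hpow.exists_encard_jumps_le a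
  have hle : (Point.jumps (a N) (p N)).encard ≤ N :=
    hN _ (fun j => Point.comap (evalHom N) (p N j))
      ((Point.comap_mono _).comp (p N).strictMono.monotone)
  rw [ha, Set.encard_univ, ENat.card_eq_coe_fintype_card, Fintype.card_fin, Nat.cast_le] at hle
  exact (hp N).not_ge hle

theorem IsStarAlgebra.point_eq_of_generators (hα : IsStarAlgebra α) {s : Set α}
    (hgen : generated s = Set.univ) {x y : Point α} (hs : ∀ a ∈ s, x a ↔ y a)
    (hlt : ∀ z, x < z ↔ y < z) : x = y := by
  have int_apply_of_int_apply {x y : Point α} (hlt : ∀ z, x < z ↔ y < z) {a : α}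
      (ha : x a ↔ y a) (hx : x (int a)) : y (int a) := by
    refine Point.int_apply_iff.mpr fun z hyz => ?_
    by_cases hzy : z ≤ y
    · rw [← hα.point_eq_of_le_of_le hyz hzy, ← ha]
      exact Point.apply_of_le (int_le a) hx
    · exact Point.int_apply_iff.mp hx z ((hlt z).mpr (lt_of_le_not_ge hyz hzy)).le
  have hS : IsSubalgebra {a | x a ↔ y a} :=
    { bot_mem := by simp
      top_mem := by simp
      sup_mem := fun {a b} ha hb => by simp_all
      inf_mem := fun {a b} ha hb => by simp_all
      compl_mem := fun {a} ha => by simp_all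
      int_mem := fun ha => ⟨int_apply_of_int_apply hlt ha,
        int_apply_of_int_apply (fun z => (hlt z).symm) ha.symm⟩ }
  exact DFunLike.ext _ _ fun a => propext (generated_subset hS hs (hgen.ge (Set.mem_univ a)))

theorem IsStarAlgebra.finite_setOf_coheight_lt (hα : IsStarAlgebra α) {s : Set α} (hs : s.Finite)
    (hgen : generated s = Set.univ) (n : ℕ) : {x : Point α | Order.coheight x < n}.Finite := by
  induction n with
  | zero => simp
  | succ n ih =>
    refine Set.Finite.of_injOn (f := fun x => ({a ∈ s | x a}, {y | x < y}))
      (t := 𝒫 s ×ˢ 𝒫 {x : Point α | Order.coheight x < n}) ?_ ?_ (hs.powerset.prod ih.powerset)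
    · intro x hx
      rw [Set.mem_ofPred_eq, Nat.cast_succ, ENat.lt_natCast_add_one_iff] at hx
      exact ⟨Set.sep_subset _ _, Order.coheight_le_coe_iff.mp hx⟩
    · intro x _ y _ hxy
      obtain ⟨hgens, hups⟩ := Prod.ext_iff.mp hxy
      refine hα.point_eq_of_generators hgen (fun a ha => ?_) (Set.ext_iff.mp hups)
      simpa [ha] using Set.ext_iff.mp hgens a

theorem finite_of_finite_point [Finite (Point α)] : Finite α := by
  refine Finite.of_injective (fun a => {x : Point α | x a}) fun a b h => le_antisymm ?_ ?_
  · exact Point.le_of_forall_apply fun x => (Set.ext_iff.mp h x).mp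
  · exact Point.le_of_forall_apply fun x => (Set.ext_iff.mp h x).mpr

theorem IsStarAlgebra.finite_of_pow (hα : IsStarAlgebra α) (hpow : IsStarAlgebra (ℕ → α))
    {s : Set α} (hs : s.Finite) (hgen : generated s = Set.univ) : Finite α := by
  obtain ⟨N, hN⟩ := hpow.exists_length_le
  have coheight_lt (x : Point α) : Order.coheight x < (N + 1 : ℕ) := by
    rw [Nat.cast_succ, ENat.lt_natCast_add_one_iff]
    exact Order.coheight_le fun p _ => Nat.cast_le.mpr (hN p)
  have hfin := hα.finite_setOf_coheight_lt hs hgen (N + 1)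
  have : Finite (Point α) := Set.finite_univ_iff.mp (hfin.subset fun x _ => coheight_lt x)
  exact finite_of_finite_point

end InteriorAlgebra

namespace IntAlg

open InteriorAlgebra

/-! ### Varieties -/

theorem Term.map_eval {α : Type u} {β : Type v} [InteriorAlgebra α] [InteriorAlgebra β]
    (h : InteriorHom α β) (x : ℕ → α) (t : Term) :
    h.toBoundedLatticeHom (t.eval x) = t.eval fun n => h.toBoundedLatticeHom (x n) := by
  induction t with
  | var n => rfl
  | bot => exact map_bot _
  | top => exact map_top _
  | sup s t hs ht => simp only [Term.eval, map_sup, hs, ht]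
  | inf s t hs ht => simp only [Term.eval, map_inf, hs, ht]
  | compl t ht => simp only [Term.eval, map_compl', ht]
  | int t ht => simp only [Term.eval, InteriorHom.map_int, ht]

theorem isVariety_isGrz : IsVariety fun A : IntAlg.{u} => IsGrz A := by
  let v : Term := .var 0
  let g : Term := .int (.sup (.compl (.int (.sup (.compl v) (.int v)))) v)
  refine ⟨{(.inf g v, g)}, fun A => ?_⟩
  simp only [Set.mem_singleton_iff, forall_eq]
  exact ⟨fun h x => inf_eq_left.mpr (h (x 0)), fun h a => inf_eq_left.mp (h fun _ => a)⟩

variable {V : ObjectProperty IntAlg.{u}}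

theorem IsVariety.of_separating (hV : IsVariety V) {A : IntAlg.{u}} {ι : Sort*}
    {B : ι → IntAlg.{u}} (hB : ∀ i, V (B i)) (h : ∀ i, InteriorHom A (B i))
    (hsep : ∀ a b : A, (∀ i, (h i).toBoundedLatticeHom a = (h i).toBoundedLatticeHom b) → a = b) :
    V A := by
  obtain ⟨E, hE⟩ := hV
  refine (hE A).mpr fun e he x => hsep _ _ fun i => ?_
  rw [Term.map_eval, Term.map_eval]
  exact (hE (B i)).mp (hB i) e he _

theorem IsVariety.subalgebra (hV : IsVariety V) {A : IntAlg.{u}} (hA : V A) {S : Set A}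
    (hS : IsSubalgebra S) : V ⟨hS.toBooleanSubalgebra⟩ :=
  hV.of_separating (fun _ : Unit => hA) (fun _ => hS.inclusion) fun _ _ h => Subtype.ext (h ())

theorem IsVariety.pi (hV : IsVariety V) {ι : Type} {A : ι → IntAlg.{u}} (hA : ∀ i, V (A i)) :
    V ⟨∀ i, A i⟩ :=
  hV.of_separating hA evalHom fun _ _ h => funext h

theorem isStarAlgebra_of_isLocallyFinite (hfin : IsLocallyFinite V) (hstar : IsStarVariety V)
    {A : IntAlg.{u}} (hA : V A) : IsStarAlgebra A := by
  have hgen : starPart V A := hstar ▸ hA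
  have hgrz : IsGrz A := hgen _ isVariety_isGrz fun _ hB => hB.2.isGrz
  exact hgrz.isStarAlgebra fun a => hfin A hA {a} (Set.finite_singleton a)

theorem isStarAlgebra_of_full (hV : IsVariety V) (hfull : (V.ι ⋙ openFunctor).Full)
    {A : IntAlg.{u}} (hA : V A) : IsStarAlgebra A := by
  let X : V.FullSubcategory := ⟨A, hA⟩
  let Y : V.FullSubcategory := ⟨_, hV.subalgebra hA (isSubalgebra_generated {a | int a = a})⟩
  obtain ⟨h, hh⟩ := hfull.map_surjective (X := X) (Y := Y) (HeytAlg.ofHom opensToGenerated)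
  exact isStarAlgebra_of_restrictOpens_eq_opensToGenerated (h := h.hom)
    (congrArg HeytAlg.Hom.hom hh)

section StarAlgebras

variable (hstar : ∀ A, V A → IsStarAlgebra A)
include hstar

theorem full_of_isStarAlgebra : (V.ι ⋙ openFunctor).Full where
  map_surjective {X Y} f := by
    obtain ⟨g, hg⟩ := (hstar X.obj X.property).exists_restrictOpens_eq f.hom
    exact ⟨ObjectProperty.homMk g, HeytAlg.hom_ext hg⟩

theorem faithful_of_isStarAlgebra : (V.ι ⋙ openFunctor).Faithful where
  map_injective {X _} _ _ e := ObjectProperty.hom_ext _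
    (InteriorHom.eq_of_restrictOpens_eq (hstar X.obj X.property) (congrArg HeytAlg.Hom.hom e))

theorem isStarVariety_of_isStarAlgebra (hV : IsVariety V) : IsStarVariety V :=
  funext fun A => propext
    ⟨fun hA _ _ hW => hW A ⟨hA, hstar A hA⟩, fun hA => hA V hV fun _ hB => hB.1⟩

theorem isLocallyFinite_of_isStarAlgebra (hV : IsVariety V) : IsLocallyFinite V := by
  intro A hA s hs
  have hB := hV.subalgebra hA (isSubalgebra_generated s)
  have : Finite (isSubalgebra_generated s).toBooleanSubalgebra :=
    (hstar _ hB).finite_of_pow (hstar _ (hV.pi fun _ : ℕ => hB))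
      (hs.preimage Subtype.val_injective.injOn) (generated_preimage_val s)
  exact Set.toFinite ((isSubalgebra_generated s).toBooleanSubalgebra : Set A)

end StarAlgebras

theorem categoricallyEquivalent_gamma (hfull : (V.ι ⋙ openFunctor).Full)
    (hfaithful : (V.ι ⋙ openFunctor).Faithful) :
    CategoricallyEquivalent V.FullSubcategory (gamma V).FullSubcategory := by
  have mem_gamma (X : V.FullSubcategory) : gamma V ((V.ι ⋙ openFunctor).obj X) :=
    ⟨X.obj, X.property, ⟨Iso.refl _⟩⟩
  refine ⟨(gamma V).lift (V.ι ⋙ openFunctor) mem_gamma,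
    Functor.Full.of_comp_faithful_iso ((gamma V).liftCompιIso _ mem_gamma),
    Functor.Faithful.of_comp_iso ((gamma V).liftCompιIso _ mem_gamma), fun L => ?_⟩
  obtain ⟨A, hA, ⟨e⟩⟩ := L.property
  exact ⟨⟨A, hA⟩, ⟨(gamma V).isoMk e⟩⟩

end IntAlg

theorem mainTheorem4 (V : ObjectProperty IntAlg.{u}) (hV : IntAlg.IsVariety V) :
    ((V.ι ⋙ IntAlg.openFunctor).Full ↔
        (IntAlg.IsLocallyFinite V ∧ IntAlg.IsStarVariety V)) ∧
      (IntAlg.IsLocallyFinite V ∧ IntAlg.IsStarVariety V →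
        CategoricallyEquivalent V.FullSubcategory (IntAlg.gamma V).FullSubcategory) := by
  have full_iff : (V.ι ⋙ IntAlg.openFunctor).Full ↔ ∀ A, V A → InteriorAlgebra.IsStarAlgebra A :=
    ⟨fun h _ => IntAlg.isStarAlgebra_of_full hV h, IntAlg.full_of_isStarAlgebra⟩
  have star_iff : IntAlg.IsLocallyFinite V ∧ IntAlg.IsStarVariety V ↔
      ∀ A, V A → InteriorAlgebra.IsStarAlgebra A :=
    ⟨fun h _ => IntAlg.isStarAlgebra_of_isLocallyFinite h.1 h.2,
      fun h => ⟨IntAlg.isLocallyFinite_of_isStarAlgebra h hV,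
        IntAlg.isStarVariety_of_isStarAlgebra h hV⟩⟩
  refine ⟨full_iff.trans star_iff.symm, fun h => ?_⟩
  have hstar := star_iff.mp h
  exact IntAlg.categoricallyEquivalent_gamma (full_iff.mpr hstar)
    (IntAlg.faithful_of_isStarAlgebra hstar)
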